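/- Let $n,p$ be nonnegative integers. Let $\mathcal E$ be the class of all laws $P$ of $(X,Y(1),Y(0),T)$ with $X\in\mathbb R^p$, $Y(1),Y(0)\in\mathbb R$, $T\in\{0,1\}$, such that at least one coordinate of $X$ has a law absolutely continuous with respect to one-dimensional Lebesgue measure, and $Y(1)$ and $Y(0)$ each have a continuous (atomless) distribution. Put $$\mathcal P_{\mathrm{SI}}=\{P\in\mathcal E:(Y(1),Y(0))\perp T\mid X\},\qquad e_P(X)=P(T=1\mid X),$$ $$\mathcal P_{\mathrm{SI}}^{\mathrm{ov}}=\{P\in\mathcal P_{\mathrm{SI}}:0<e_P(X)<1\text{ a.s.}\},$$ $$\mathcal P_{\mathrm{SI}}^{(r)}=\{P\in\mathcal P_{\mathrm{SI}}:\mathbb E_P[e_P(X)^{-r}(1-e_P(X))^{-r}]<\infty\}\quad(r\in(0,\infty)),$$ $$\mathcal P_{\mathrm{SI}}^{\mathrm{str}}=\{P\in\mathcal P_{\mathrm{SI}}:e_P(X)\in[c_P,1-c_P]\text{ a.s. for some }c_P>0\}.$$ Let $\Delta=Y(1)-Y(0)$ and let $\widehat C_{n,\alpha}$ be a (possibly randomized)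 prediction set, that is, a map $x\mapsto\widehat C_{n,\alpha}(x)$ from $\mathbb R^p$ to the Borel subsets of $\mathbb R$ constructed from the observed data $(X_i,T_i,Y_i)_{i=1}^n$, where $Y_i=T_iY_i(1)+(1-T_i)Y_i(0)$, and possibly from auxiliary randomness that is independent of all data and whose law does not depend on $P$; assume that $\mathbf 1\{y\in\widehat C_{n,\alpha}(x)\}$ is jointly measurable in the observed data, the auxiliary randomness, $x$ and $y$. Below, $\mathbb P_P$ and $\mathbb E_P$ refer to $n$ i.i.d. units from $P$, an independent new unit from $P$ with covariates $X$ and effect $\Delta$, and the auxiliary randomness; $\mathrm{length}$ is Lebesgue measure. **Theorem.** Let $\mathcal P$ be any one of $\mathcal P_{\mathrm{SI}}^{\mathrm{ov}}$, $\mathcal P_{\mathrm{SI}}^{(r)}$ (for some $r\in(0,\infty)$), $\mathcal P_{\mathrm{SI}}^{\mathrm{str}}$, and suppose that for some $\alpha\in(0,1)$ $$\sup_{P\in\mathcal P}\mathbb P_P\bigl(\Delta\notin\widehat C_{n,\alpha}(X)\bigr)\le\alpha.$$ Then, for every $P\in\mathcal P_{\mathrm{SI}}$ and every $y\in\mathbb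 R$, $$\mathbb P_P\bigl(y\notin\widehat C_{n,\alpha}(X)\bigr)\le\alpha,$$ and consequently, for every $P\in\mathcal P_{\mathrm{SI}}$, $\mathbb E_P\bigl[\mathrm{length}(\widehat C_{n,\alpha}(X))\bigr]=\infty$. -/

import Mathlib

open MeasureTheory ProbabilityTheory

namespace ITE

/-- Full data of one unit: `(X, (Y(1), Y(0)), T)` with `X ∈ ℝ^p` and `T` binary. -/
abbrev FullData (p : ℕ) : Type := (Fin p → ℝ) × (ℝ × ℝ) × Bool

/-- Observed data of one unit: `(X, T, Y)`. -/
abbrev ObsData (p : ℕ) : Type := (Fin p → ℝ) × Bool × ℝ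

variable {p : ℕ}

/-- The covariates `X`. -/
def cov (z : FullData p) : Fin p → ℝ := z.1

/-- The pair of potential outcomes `(Y(1), Y(0))`. -/
def outcomes (z : FullData p) : ℝ × ℝ := z.2.1

/-- The potential outcome `Y(1)`. -/
def y1 (z : FullData p) : ℝ := z.2.1.1

/-- The potential outcome `Y(0)`. -/
def y0 (z : FullData p) : ℝ := z.2.1.2

/-- The treatment indicator `T`. -/
def treat (z : FullData p) : Bool := z.2.2

/-- The individual treatment effect `Δ = Y(1) - Y(0)`. -/
def effect (z : FullData p) : ℝ := y1 z - y0 z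

/-- The observed part `(X, T, Y)` of a unit, with `Y = T Y(1) + (1 - T) Y(0)`. -/
def observe (z : FullData p) : ObsData p :=
  (cov z, treat z, if treat z = true then y1 z else y0 z)

theorem measurable_cov : Measurable (cov : FullData p → Fin p → ℝ) := measurable_fst

/-- The class `ℰ` of laws of `(X, Y(1), Y(0), T)` for which some coordinate of `X` is absolutely
continuous with respect to Lebesgue measure and `Y(1)`, `Y(0)` are continuously distributed
(each has a law without atoms, that is, a continuous distribution function). -/
def classE (p : ℕ) : Set (ProbabilityMeasure (FullData p)) :=
  {P | (∃ j : Fin p, (P : Measure (FullData p)).map (fun z => cov z j) ≪ volume) ∧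
    NullSingletonClass ((P : Measure (FullData p)).map y1) ∧
    NullSingletonClass ((P : Measure (FullData p)).map y0)}

/-- The strong-ignorability class: laws in `ℰ` with `(Y(1), Y(0)) ⟂ T ∣ X`. -/
def classSI (p : ℕ) : Set (ProbabilityMeasure (FullData p)) :=
  {P | P ∈ classE p ∧
    CondIndepFun (MeasurableSpace.comap cov inferInstance) measurable_cov.comap_le
      outcomes treat (P : Measure (FullData p))}

/-- The propensity score `e_P(X) = P(T = 1 ∣ X)`, as a random variable (a conditional
expectation with respect to `σ(X)`, determined almost surely). -/
noncomputable def propensity (P : ProbabilityMeasure (FullData p)) : FullData p → ℝ :=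
  condExp (MeasurableSpace.comap cov inferInstance) (P : Measure (FullData p))
    (Set.indicator {z | treat z = true} (fun _ => (1 : ℝ)))

/-- Weak overlap: `0 < e_P(X) < 1` almost surely. -/
def classOv (p : ℕ) : Set (ProbabilityMeasure (FullData p)) :=
  {P | P ∈ classSI p ∧
    ∀ᵐ z ∂(P : Measure (FullData p)), 0 < propensity P z ∧ propensity P z < 1}

/-- Moment overlap: `E_P[e_P(X)^{-r} (1 - e_P(X))^{-r}] < ∞`. The integrand is
extended-real-valued, with `0^{-r} = ∞` for `r > 0`. -/
def classMoment (p : ℕ) (r : ℝ) : Set (ProbabilityMeasure (FullData p)) :=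
  {P | P ∈ classSI p ∧
    ∫⁻ z, ENNReal.ofReal (propensity P z) ^ (-r) * ENNReal.ofReal (1 - propensity P z) ^ (-r)
      ∂(P : Measure (FullData p)) < ⊤}

/-- Strong overlap: `e_P(X) ∈ [c, 1 - c]` almost surely for some `c > 0` depending on `P`. -/
def classStr (p : ℕ) : Set (ProbabilityMeasure (FullData p)) :=
  {P | P ∈ classSI p ∧ ∃ c : ℝ, 0 < c ∧
    ∀ᵐ z ∂(P : Measure (FullData p)), propensity P z ∈ Set.Icc c (1 - c)}

/-- A (possibly randomized) prediction set built from `n` observed units. The first argument is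
the auxiliary randomness; a nonrandomized set is one that ignores it. The indicator of
`y ∈ Ĉ(x)` is jointly measurable in all arguments. -/
structure PredictionSet (Ω : Type*) [MeasurableSpace Ω] (n p : ℕ) where
  /-- The set `Ĉ(x)` computed from the auxiliary randomness, the observed sample and `x`. -/
  toSet : Ω → (Fin n → ObsData p) → (Fin p → ℝ) → Set ℝ
  measurableSet_graph :
    MeasurableSet {w : Ω × (Fin n → ObsData p) × (Fin p → ℝ) × ℝ | w.2.2.2 ∈ toSet w.1 w.2.1 w.2.2.1}

variable {Ω : Type*} [MeasurableSpace Ω] {n : ℕ}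

/-- The joint law of the auxiliary randomness, `n` i.i.d. units and an independent new unit. -/
noncomputable def experiment (ν : Measure Ω) (n : ℕ) (P : ProbabilityMeasure (FullData p)) :
    Measure (Ω × (Fin n → FullData p) × FullData p) :=
  ν.prod ((Measure.pi fun _ : Fin n => (P : Measure (FullData p))).prod
    (P : Measure (FullData p)))

/-- The realized set `Ĉ(X)` at the covariates of the new unit. -/
def PredictionSet.atNew (C : PredictionSet Ω n p) (w : Ω × (Fin n → FullData p) × FullData p) :
    Set ℝ :=
  C.toSet w.1 (fun i => observe (w.2.1 i)) (cov w.2.2)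

/-- `ℙ_P(Δ ∉ Ĉ(X))`. -/
noncomputable def PredictionSet.missEffect (C : PredictionSet Ω n p) (ν : Measure Ω)
    (P : ProbabilityMeasure (FullData p)) : ENNReal :=
  experiment ν n P {w | effect w.2.2 ∉ C.atNew w}

/-- `ℙ_P(y ∉ Ĉ(X))` for a fixed real number `y`. -/
noncomputable def PredictionSet.missPoint (C : PredictionSet Ω n p) (ν : Measure Ω)
    (P : ProbabilityMeasure (FullData p)) (y : ℝ) : ENNReal :=
  experiment ν n P {w | y ∉ C.atNew w}

/-- `E_P[length(Ĉ(X))]`, with values in `[0, ∞]`. -/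
noncomputable def PredictionSet.expectedLength (C : PredictionSet Ω n p) (ν : Measure Ω)
    (P : ProbabilityMeasure (FullData p)) : ENNReal :=
  ∫⁻ w, volume (C.atNew w) ∂(experiment ν n P)

/-- Finite-sample distribution-free validity at level `1 - α` over the class `𝓟`. -/
def PredictionSet.FiniteSampleValid (C : PredictionSet Ω n p) (ν : Measure Ω)
    (𝓟 : Set (ProbabilityMeasure (FullData p))) (α : ℝ) : Prop :=
  (⨆ P ∈ 𝓟, C.missEffect ν P) ≤ ENNReal.ofReal α

end ITE

/-! The observed data never show both outcomes of a unit, so they cannot refute any value of the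
effect if treatment is determined by the covariates. Suppose first that `T = A(X)`. Refilling each
unobserved outcome makes the effect identically `y` and changes neither the data nor the
covariates. Redrawing `T` so that it deviates from `A(X)` with small probability then gives strong
ignorability and strong overlap, while the `n + 1` units are left untouched with probability close
to `1`. Validity at the perturbed law therefore forces `y` to be missed with probability at most
`α` under the original one.

Any law is, for samples, nearly a mixture of such laws. Cut the covariate space into finitely many
cells and draw an independent label `A(c) ∼ P(T ∣ X ∈ c)` for every cell `c`. Conditioning `P` on
`T = A(c)` in each cell, sampling i.i.d. and averaging over `A` reproduces the i.i.d. law `P^(n+1)`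
on samples whose units lie in distinct cells. Since `X` has no atoms, finer and finer partitions
eventually separate the units almost surely.

Finally, every `y ∈ ℝ` is covered with probability at least `1 - α > 0`, and Fubini turns this into
infinite expected length. -/

namespace ITE

section ProductMeasures

variable {ι : Type*} [Fintype ι]

theorem smul_pi_le_pi {α : ι → Type*} [∀ i, MeasurableSpace (α i)] {μ ν : ∀ i, Measure (α i)}
    [∀ i, SigmaFinite (μ i)] {c : ι → ENNReal} (h : ∀ i, c i • μ i ≤ ν i) :
    (∏ i, c i) • Measure.pi μ ≤ Measure.pi ν := by
  have houter : ((∏ i, c i) • Measure.pi μ).toOuterMeasure ≤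
      OuterMeasure.pi fun i => (ν i).toOuterMeasure := by
    refine OuterMeasure.le_pi.2 fun s _ => ?_
    calc ((∏ i, c i) • Measure.pi μ) (Set.univ.pi s) = ∏ i, (c i • μ i) (s i) := by
          simp only [Measure.smul_apply, Measure.pi_pi, smul_eq_mul, Finset.prod_mul_distrib]
      _ ≤ ∏ i, ν i (s i) := Finset.prod_le_prod' fun i _ => h i (s i)
  intro s
  rw [Measure.pi_def ν]
  exact (houter s).trans (le_toMeasure_apply _ _ s)

theorem pi_withDensity {α : ι → Type*} [∀ i, MeasurableSpace (α i)] (μ : ∀ i, Measure (α i))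
    [∀ i, IsProbabilityMeasure (μ i)] {f : ∀ i, α i → ENNReal} (hf : ∀ i, Measurable (f i))
    [∀ i, SigmaFinite ((μ i).withDensity (f i))] :
    Measure.pi (fun i => (μ i).withDensity (f i)) =
      (Measure.pi μ).withDensity fun x => ∏ i, f i (x i) := by
  refine Measure.pi_eq fun s hs => ?_
  have hsf : ∀ i, Measurable ((s i).indicator (f i)) := fun i => (hf i).indicator (hs i)
  have hbox : (Set.univ.pi s).indicator (fun x => ∏ i, f i (x i)) =
      fun x => ∏ i, (s i).indicator (f i) (x i) := by
    classical
    ext x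
    simp only [Set.indicator_apply, Set.mem_univ_pi, Finset.prod_ite_zero, Finset.mem_univ,
      forall_const]
  rw [withDensity_apply _ (.univ_pi hs), ← lintegral_indicator (.univ_pi hs), hbox,
    lintegral_prod_eq_prod_lintegral_of_indepFun Finset.univ _
      (iIndepFun_pi fun i => (hsf i).aemeasurable)
      fun i => (hsf i).comp (measurable_pi_apply i)]
  refine Finset.prod_congr rfl fun i _ => ?_
  rw [withDensity_apply _ (hs i), ← lintegral_indicator (hs i)]
  exact (measurePreserving_eval μ i).lintegral_comp (hsf i)

end ProductMeasures

theorem measurePreserving_init_last {n : ℕ} {α : Type*} [MeasurableSpace α] (μ : Measure α)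
    [SigmaFinite μ] :
    MeasurePreserving
      (fun z : Fin (n + 1) → α => ((fun i : Fin n => z i.castSucc), z (Fin.last n)))
      (Measure.pi fun _ => μ) ((Measure.pi fun _ => μ).prod μ) := by
  have h := Measure.measurePreserving_swap.comp
    (measurePreserving_piFinSuccAbove (fun _ : Fin (n + 1) => μ) (Fin.last n))
  convert h using 1
  ext z i
  · simp [MeasurableEquiv.piFinSuccAbove, Fin.init]
  · simp [MeasurableEquiv.piFinSuccAbove]

theorem ae_singleton_ne_zero {τ : Type*} [Countable τ] [MeasurableSpace τ] (μ : Measure τ) :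
    ∀ᵐ b ∂μ, μ {b} ≠ 0 := by
  refine measure_mono_null (fun b hb => ?_)
    ((measure_biUnion_null_iff (Set.to_countable {b | μ {b} = 0})).2 fun _ hb => hb)
  simpa using hb

section NullSingletons

variable {α β : Type*} [MeasurableSpace α] [MeasurableSpace β] {μ : Measure α}

theorem nullSingletonClass_map_of_injective [MeasurableSingletonClass β] [NullSingletonClass μ]
    {f : α → β} (hf : Measurable f) (hinj : Function.Injective f) :
    NullSingletonClass (μ.map f) where
  measure_singleton x := by
    rw [Measure.map_apply hf (measurableSet_singleton x)]
    exact (Set.subsingleton_singleton.preimage hinj).measure_zero μ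

theorem nullSingletonClass_map_of_eq_or_eq [MeasurableSingletonClass β] {f g h : α → β}
    (hf : Measurable f) (hg : Measurable g) (hh : Measurable h)
    [hμg : NullSingletonClass (μ.map g)] [hμh : NullSingletonClass (μ.map h)]
    (hfgh : ∀ z, f z = g z ∨ f z = h z) : NullSingletonClass (μ.map f) where
  measure_singleton x := by
    have hgx := hμg.measure_singleton x
    have hhx := hμh.measure_singleton x
    rw [Measure.map_apply hg (measurableSet_singleton x)] at hgx
    rw [Measure.map_apply hh (measurableSet_singleton x)] at hhx
    rw [Measure.map_apply hf (measurableSet_singleton x)]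
    exact measure_mono_null (fun z hz => (hfgh z).imp (·.symm.trans hz) (·.symm.trans hz))
      (measure_union_null hgx hhx)

theorem nullSingletonClass_of_map [MeasurableSingletonClass β] {f : α → β} (hf : Measurable f)
    [h : NullSingletonClass (μ.map f)] : NullSingletonClass μ where
  measure_singleton x := by
    have hfx := h.measure_singleton (f x)
    rw [Measure.map_apply hf (measurableSet_singleton _)] at hfx
    exact measure_mono_null (fun z hz => congrArg f hz) hfx

end NullSingletons

section Distinct

variable {Ω β : Type*} [MeasurableSpace Ω] [MeasurableSpace β] [MeasurableEq β] {μ : Measure Ω}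

theorem ae_ne_of_indepFun [IsFiniteMeasure μ] {X Y : Ω → β} (hX : AEMeasurable X μ)
    (hY : AEMeasurable Y μ) (h : X ⟂ᵢ[μ] Y) [NullSingletonClass (μ.map Y)] :
    ∀ᵐ ω ∂μ, X ω ≠ Y ω := by
  have hprod : ∀ᵐ q ∂(μ.map X).prod (μ.map Y), q.1 ≠ q.2 :=
    (Measure.ae_prod_iff_ae_ae measurableSet_diagonal.compl).2 <|
      .of_forall fun x => by
        filter_upwards [(Set.countable_singleton x).ae_notMem (μ.map Y)] with y hy hxy
        exact hy hxy.symm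
  rw [← (indepFun_iff_map_prod_eq_prod_map_map hX hY).1 h] at hprod
  exact ae_of_ae_map (hX.prodMk hY) hprod

theorem ae_injective_of_iIndepFun {ι : Type*} [Countable ι] [IsFiniteMeasure μ] {X : ι → Ω → β}
    (hX : ∀ i, AEMeasurable (X i) μ) (h : iIndepFun X μ)
    [∀ i, NullSingletonClass (μ.map (X i))] :
    ∀ᵐ ω ∂μ, Function.Injective fun i => X i ω := by
  have hne : ∀ᵐ ω ∂μ, ∀ i j, i ≠ j → X i ω ≠ X j ω := by
    simp only [ae_all_iff]
    exact fun i j hij => ae_ne_of_indepFun (hX i) (hX j) (h.indepFun hij)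
  filter_upwards [hne] with ω hω i j
  exact not_imp_not.1 (hω i j)

theorem ae_injective_comp_eval {α ι : Type*} [MeasurableSpace α] [Fintype ι] {μ : Measure α}
    [IsProbabilityMeasure μ] {X : α → β} (hX : Measurable X) [hμ : NullSingletonClass (μ.map X)] :
    ∀ᵐ z ∂Measure.pi (fun _ : ι => μ), Function.Injective fun i => X (z i) := by
  have : ∀ i, NullSingletonClass ((Measure.pi fun _ : ι => μ).map fun z => X (z i)) := fun i => by
    rwa [show (fun z : ι → α => X (z i)) = X ∘ Function.eval i from rfl,
      ← Measure.map_map hX (measurable_pi_apply i),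
      (measurePreserving_eval (fun _ : ι => μ) i).map_eq]
  exact ae_injective_of_iIndepFun (fun i => (hX.comp (measurable_pi_apply i)).aemeasurable)
    (iIndepFun_pi fun _ => hX.aemeasurable)

end Distinct

section Labels

variable {α κ τ : Type*} [MeasurableSpace α] [MeasurableSpace κ] [MeasurableSpace τ]
  [Countable τ] [MeasurableSingletonClass τ] [Nonempty τ] {μ : Measure α} [IsFiniteMeasure μ]
  {k : α → κ} {t : α → τ}

open Classical in
/-- The density, with respect to `μ`, of the law that keeps the distribution of the cell `k` and
conditions `μ` on `t = A c` within each cell `c`. It has total mass `1` as soon as each of these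
conditioning events has positive conditional probability. -/
noncomputable def labelDensity (μ : Measure α) [IsFiniteMeasure μ] (k : α → κ) (t : α → τ)
    (A : κ → τ) (z : α) : ENNReal :=
  if t z = A (k z) then (condDistrib t k μ (k z) {A (k z)})⁻¹ else 0

section Countable

variable [Countable κ] [MeasurableSingletonClass κ] {A : κ → τ}

theorem measurable_labelDensity (hk : Measurable k) (ht : Measurable t) :
    Measurable (labelDensity μ k t A) :=
  Measurable.ite (measurableSet_eq_fun ht ((measurable_of_countable A).comp hk))
    ((measurable_of_countable fun c => (condDistrib t k μ c {A c})⁻¹).comp hk) measurable_const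

theorem ae_eq_label (hk : Measurable k) (ht : Measurable t) :
    ∀ᵐ z ∂μ.withDensity (labelDensity μ k t A), t z = A (k z) := by
  refine (ae_withDensity_iff (measurable_labelDensity hk ht)).2 (.of_forall fun z hz => ?_)
  by_contra h
  exact hz (if_neg h)

theorem ae_condDistrib_singleton_ne_zero (hk : Measurable k) (ht : Measurable t) :
    ∀ᵐ z ∂μ, condDistrib t k μ (k z) {t z} ≠ 0 := by
  have hjoint : ∀ᵐ q ∂μ.map k ⊗ₘ condDistrib t k μ, condDistrib t k μ q.1 {q.2} ≠ 0 :=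
    Measure.ae_compProd_of_ae_ae (Set.to_countable _).measurableSet
      (.of_forall fun c => ae_singleton_ne_zero _)
  rw [compProd_map_condDistrib ht.aemeasurable] at hjoint
  exact ae_of_ae_map (hk.prodMk ht).aemeasurable hjoint

theorem lintegral_labelDensity (hk : Measurable k) (ht : Measurable t) :
    ∫⁻ z, labelDensity μ k t A z ∂μ =
      ∫⁻ c, (condDistrib t k μ c {A c})⁻¹ * condDistrib t k μ c {A c} ∂μ.map k := by
  classical
  have hF : Measurable fun q : κ × τ =>
      if q.2 = A q.1 then (condDistrib t k μ q.1 {A q.1})⁻¹ else 0 := measurable_of_countable _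
  calc ∫⁻ z, labelDensity μ k t A z ∂μ
      = ∫⁻ q : κ × τ, (if q.2 = A q.1 then (condDistrib t k μ q.1 {A q.1})⁻¹ else 0)
          ∂μ.map k ⊗ₘ condDistrib t k μ := by
        rw [compProd_map_condDistrib ht.aemeasurable, lintegral_map hF (hk.prodMk ht)]
        simp only [labelDensity]
    _ = ∫⁻ c, (condDistrib t k μ c {A c})⁻¹ * condDistrib t k μ c {A c} ∂μ.map k := by
        rw [Measure.lintegral_compProd hF]
        refine lintegral_congr fun c => ?_
        rw [← lintegral_indicator_const (measurableSet_singleton (A c))]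
        simp only [Set.indicator_apply, Set.mem_singleton_iff]

theorem isProbabilityMeasure_withDensity_labelDensity {μ : Measure α} [IsProbabilityMeasure μ]
    (hk : Measurable k) (ht : Measurable t) (hA : ∀ c, condDistrib t k μ c {A c} ≠ 0) :
    IsProbabilityMeasure (μ.withDensity (labelDensity μ k t A)) := by
  have := Measure.isProbabilityMeasure_map (μ := μ) hk.aemeasurable
  refine ⟨?_⟩
  simp only [withDensity_apply _ MeasurableSet.univ, Measure.restrict_univ,
    lintegral_labelDensity hk ht, ENNReal.inv_mul_cancel (hA _) (measure_ne_top _ _),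
    lintegral_one, measure_univ]

theorem prod_pi_withDensity_labelDensity_apply {ι Ω : Type*} [Fintype ι] [MeasurableSpace Ω]
    {ν : Measure Ω} {μ : Measure α} [IsProbabilityMeasure μ] {B : Set (Ω × (ι → α))}
    (hk : Measurable k) (ht : Measurable t)
    (hA : ∀ c, condDistrib t k μ c {A c} ≠ 0) (hB : MeasurableSet B) :
    (ν.prod (Measure.pi fun _ => μ.withDensity (labelDensity μ k t A))) B =
      ∫⁻ w in B, ∏ i, labelDensity μ k t A (w.2 i) ∂ν.prod (Measure.pi fun _ => μ) := by
  have := isProbabilityMeasure_withDensity_labelDensity hk ht hA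
  have hf : Measurable (labelDensity μ k t A) := measurable_labelDensity hk ht
  rw [pi_withDensity _ fun _ => hf, prod_withDensity_right (by fun_prop), withDensity_apply _ hB]

end Countable

theorem lintegral_prod_labelDensity [Fintype κ] {ι : Type*} [Fintype ι] {z : ι → α}
    (hz : Function.Injective fun i => k (z i))
    (hw : ∀ i, condDistrib t k μ (k (z i)) {t (z i)} ≠ 0) :
    ∫⁻ A, ∏ i, labelDensity μ k t A (z i) ∂Measure.pi (condDistrib t k μ) = 1 := by
  set w := condDistrib t k μ with hwdef
  let φ (i : ι) : τ → ENNReal :=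
    ({t (z i)} : Set τ).indicator fun _ => (w (k (z i)) {t (z i)})⁻¹
  have hφ : ∀ i, Measurable (φ i) := fun _ => measurable_of_countable _
  have hind : iIndepFun (fun i (A : κ → τ) => φ i (A (k (z i)))) (Measure.pi w) :=
    ((iIndepFun_pi (X := fun _ (b : τ) => b) fun _ => aemeasurable_id).precomp hz).comp φ hφ
  calc ∫⁻ A, ∏ i, labelDensity μ k t A (z i) ∂Measure.pi w
      = ∫⁻ A, ∏ i, φ i (A (k (z i))) ∂Measure.pi w := by
        refine lintegral_congr fun A => Finset.prod_congr rfl fun i _ => ?_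
        by_cases h : t (z i) = A (k (z i))
        · simp [φ, labelDensity, h, hwdef]
        · simp [φ, labelDensity, h, Ne.symm h]
    _ = ∏ i, ∫⁻ A, φ i (A (k (z i))) ∂Measure.pi w :=
        lintegral_prod_eq_prod_lintegral_of_indepFun Finset.univ _ hind
          fun i => (hφ i).comp (measurable_pi_apply _)
    _ = ∏ i : ι, 1 := by
        refine Finset.prod_congr rfl fun i _ => ?_
        rw [(measurePreserving_eval w (k (z i))).lintegral_comp (hφ i),
          lintegral_indicator_const (measurableSet_singleton _),
          ENNReal.inv_mul_cancel (hw i) (measure_ne_top _ _)]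
    _ = 1 := Finset.prod_const_one

theorem measure_inter_injective_le_of_forall_label [Finite κ] [MeasurableSingletonClass κ]
    {ι Ω : Type*} [Fintype ι] [MeasurableSpace Ω] {ν : Measure Ω} [SFinite ν] {μ : Measure α}
    [IsProbabilityMeasure μ] {B : Set (Ω × (ι → α))} (hk : Measurable k) (ht : Measurable t)
    (hB : MeasurableSet B) {a : ENNReal}
    (h : ∀ A : κ → τ, (∀ c, condDistrib t k μ c {A c} ≠ 0) →
      (ν.prod (Measure.pi fun _ => μ.withDensity (labelDensity μ k t A))) B ≤ a) :
    (ν.prod (Measure.pi fun _ => μ)) (B ∩ {w | Function.Injective fun i => k (w.2 i)}) ≤ a := by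
  have := Fintype.ofFinite κ
  let w := condDistrib t k μ
  let σ := ν.prod (Measure.pi fun _ : ι => μ)
  let D : Set (Ω × (ι → α)) := {w | Function.Injective fun i => k (w.2 i)}
  let F (A : κ → τ) (q : Ω × (ι → α)) : ENNReal := ∏ i, labelDensity μ k t A (q.2 i)
  have hF : ∀ A, Measurable (F A) := fun A => Finset.measurable_prod _ fun i _ =>
    (measurable_labelDensity hk ht).comp ((measurable_pi_apply i).comp measurable_snd)
  have hD : MeasurableSet D := by
    have : Measurable fun (q : Ω × (ι → α)) i => k (q.2 i) := by fun_prop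
    exact this (Set.to_countable {g : ι → κ | Function.Injective g}).measurableSet
  have hw : ∀ᵐ q ∂σ, ∀ i, w (k (q.2 i)) {t (q.2 i)} ≠ 0 :=
    Measure.quasiMeasurePreserving_snd.ae <| ae_all_iff.2 fun i =>
      (Measure.tendsto_eval_ae_ae (i := i)).eventually (ae_condDistrib_singleton_ne_zero hk ht)
  have hA : ∀ᵐ A ∂Measure.pi w, ∀ c, w c {A c} ≠ 0 := ae_all_iff.2 fun c =>
    (Measure.tendsto_eval_ae_ae (i := c)).eventually (ae_singleton_ne_zero (w c))
  calc σ (B ∩ D) = ∫⁻ _ in B ∩ D, 1 ∂σ := (setLIntegral_one _).symm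
    _ = ∫⁻ q in B ∩ D, ∫⁻ A, F A q ∂Measure.pi w ∂σ := by
        refine setLIntegral_congr_fun_ae (hB.inter hD) ?_
        filter_upwards [hw] with q hq hqD
        exact (lintegral_prod_labelDensity hqD.2 hq).symm
    _ = ∫⁻ A, ∫⁻ q in B ∩ D, F A q ∂σ ∂Measure.pi w :=
        lintegral_lintegral_swap (measurable_from_prod_countable_left hF).aemeasurable
    _ ≤ ∫⁻ _, a ∂Measure.pi w := by
        refine lintegral_mono_ae ?_
        filter_upwards [hA] with A hA
        calc ∫⁻ q in B ∩ D, F A q ∂σ ≤ ∫⁻ q in B, F A q ∂σ :=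
              lintegral_mono_set Set.inter_subset_left
          _ ≤ a := (prod_pi_withDensity_labelDensity_apply hk ht hA hB).symm.trans_le (h A hA)
    _ = a := by rw [lintegral_const, measure_univ, mul_one]

end Labels

section LabelReduction

theorem eventually_injective_restrict {ι γ : Type*} [Finite ι] {x : ι → ℕ → γ}
    (hx : Function.Injective x) :
    ∀ᶠ M in Filter.atTop, Function.Injective fun i (m : Fin M) => x i m := by
  have hne : ∀ᶠ M in Filter.atTop, ∀ i j, i ≠ j →
      (fun m : Fin M => x i m) ≠ fun m : Fin M => x j m := by
    simp only [Filter.eventually_all]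
    intro i j hij
    obtain ⟨m, hm⟩ := Function.ne_iff.1 (hx.ne hij)
    filter_upwards [Filter.eventually_gt_atTop m] with M hM h
    exact hm (congrFun h ⟨m, hM⟩)
  filter_upwards [hne] with M hM i j
  exact not_imp_not.1 (hM i j)

variable {α β τ ι Ω : Type*} [MeasurableSpace α] [MeasurableSpace β]
  [MeasurableSpace.CountablySeparated β] [MeasurableSpace τ]
  [Countable τ] [MeasurableSingletonClass τ] [Nonempty τ] [Fintype ι] [MeasurableSpace Ω]

theorem prod_pi_le_of_forall_label {ν : Measure Ω} [IsFiniteMeasure ν] {μ : Measure α}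
    [IsProbabilityMeasure μ] {X : α → β} (hX : Measurable X) [NullSingletonClass (μ.map X)]
    {t : α → τ} (ht : Measurable t) {B : Set (Ω × (ι → α))} (hB : MeasurableSet B) {a : ENNReal}
    (h : ∀ (μ' : Measure α) [IsProbabilityMeasure μ'], μ' ≪ μ →
      ∀ A : β → τ, Measurable A → (∀ᵐ z ∂μ', t z = A (X z)) →
        (ν.prod (Measure.pi fun _ => μ')) B ≤ a) :
    (ν.prod (Measure.pi fun _ => μ)) B ≤ a := by
  obtain ⟨f, hf, hinj⟩ := MeasurableSpace.measurable_injection_nat_bool_of_countablySeparated β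
  let cell (M : ℕ) (x : β) (m : Fin M) : Bool := f x m
  have hcell : ∀ M, Measurable (cell M) := fun M => by fun_prop
  have hbound : ∀ M, (ν.prod (Measure.pi fun _ => μ))
      (B ∩ {w | Function.Injective fun i => cell M (X (w.2 i))}) ≤ a := fun M => by
    have hk : Measurable fun z => cell M (X z) := (hcell M).comp hX
    refine measure_inter_injective_le_of_forall_label hk ht hB fun A hA => ?_
    have := isProbabilityMeasure_withDensity_labelDensity hk ht hA
    exact h _ (withDensity_absolutelyContinuous _ _) (fun x => A (cell M x))
      ((measurable_of_countable A).comp (hcell M)) (ae_eq_label hk ht)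
  have : MeasurableEq β := ⟨by
    have := measurableSet_eq_fun (hf.comp measurable_fst) (hf.comp (measurable_snd (α := β)))
    simp only [Function.comp_apply, hinj.eq_iff] at this
    exact this⟩
  have hdistinct : ∀ᵐ w ∂ν.prod (Measure.pi fun _ : ι => μ),
      Function.Injective fun i => X (w.2 i) :=
    Measure.quasiMeasurePreserving_snd.ae (ae_injective_comp_eval hX)
  refine le_of_tendsto' (tendsto_measure_of_ae_tendsto_indicator_of_isFiniteMeasure Filter.atTop
    hB (fun M => hB.inter ?_) ?_) hbound
  · have : Measurable fun (q : Ω × (ι → α)) i => cell M (X (q.2 i)) := by fun_prop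
    exact this (Set.to_countable {g : ι → Fin M → Bool | Function.Injective g}).measurableSet
  · filter_upwards [hdistinct] with w hw
    filter_upwards [eventually_injective_restrict (hinj.comp hw)] with M hM
    exact and_iff_left hM

end LabelReduction

section ConditionalLaw

variable {α β γ τ : Type*} [MeasurableSpace α] [MeasurableSpace β] [MeasurableSpace γ]
  [MeasurableSpace τ] [StandardBorelSpace τ] [Nonempty τ] {μ : Measure α} [IsFiniteMeasure μ]
  {X : α → β} {Y : α → γ} {T : α → τ} {e : Kernel β τ} [IsMarkovKernel e]

theorem condDistrib_ae_eq_of_map_eq_compProd_prodMkRight (hX : Measurable X) (hY : Measurable Y)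
    (hT : Measurable T)
    (h : μ.map (fun z => ((X z, Y z), T z)) = μ.map (fun z => (X z, Y z)) ⊗ₘ e.prodMkRight γ) :
    condDistrib T X μ =ᵐ[μ.map X] e := by
  refine condDistrib_ae_eq_of_measure_eq_compProd X hT.aemeasurable (Measure.ext fun s hs => ?_)
  have hdrop : Measurable fun q : (β × γ) × τ => (q.1.1, q.2) := by fun_prop
  calc μ.map (fun z => (X z, T z)) s
      = μ.map (fun z => ((X z, Y z), T z)) ((fun q => (q.1.1, q.2)) ⁻¹' s) := by
        rw [Measure.map_apply (by fun_prop) hs, Measure.map_apply (by fun_prop) (hdrop hs)]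
        rfl
    _ = ∫⁻ z, e (X z) (Prod.mk (X z) ⁻¹' s) ∂μ := by
        rw [h, Measure.compProd_apply (hdrop hs),
          lintegral_map (Kernel.measurable_kernel_prodMk_left (hdrop hs)) (by fun_prop)]
        rfl
    _ = (μ.map X ⊗ₘ e) s := by
        rw [Measure.compProd_apply hs, lintegral_map (Kernel.measurable_kernel_prodMk_left hs) hX]

theorem condIndepFun_of_map_eq_compProd_prodMkRight [StandardBorelSpace α] [StandardBorelSpace γ]
    [Nonempty γ] (hX : Measurable X) (hY : Measurable Y) (hT : Measurable T)
    (h : μ.map (fun z => ((X z, Y z), T z)) = μ.map (fun z => (X z, Y z)) ⊗ₘ e.prodMkRight γ) :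
    Y ⟂ᵢ[X, hX; μ] T := by
  refine (condIndepFun_iff_condDistrib_prod_ae_eq_prodMkRight hT hY hX).2 ?_
  have hXe := condDistrib_ae_eq_of_map_eq_compProd_prodMkRight hX hY hT h
  have hXYe := condDistrib_ae_eq_of_measure_eq_compProd _ hT.aemeasurable h
  refine hXYe.trans ?_
  have hfst : ∀ᵐ q ∂μ.map fun z => (X z, Y z), condDistrib T X μ q.1 = e q.1 := by
    have hX' : Measurable fun z => (X z, Y z) := hX.prodMk hY
    rw [← Measure.fst_map_prodMk hY] at hXe
    exact ae_of_ae_map measurable_fst.aemeasurable hXe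
  filter_upwards [hfst] with q hq using hq.symm

end ConditionalLaw

variable {p : ℕ}

theorem measurable_outcomes : Measurable (outcomes : FullData p → ℝ × ℝ) :=
  measurable_fst.comp measurable_snd

theorem measurable_y1 : Measurable (y1 : FullData p → ℝ) :=
  measurable_fst.comp measurable_outcomes

theorem measurable_y0 : Measurable (y0 : FullData p → ℝ) :=
  measurable_snd.comp measurable_outcomes

theorem measurable_treat : Measurable (treat : FullData p → Bool) :=
  measurable_snd.comp measurable_snd

theorem measurable_effect : Measurable (effect : FullData p → ℝ) :=
  measurable_y1.sub measurable_y0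

theorem measurable_observe : Measurable (observe : FullData p → ObsData p) :=
  measurable_cov.prodMk <| measurable_treat.prodMk <|
    Measurable.ite (measurable_treat (measurableSet_singleton true)) measurable_y1 measurable_y0

section RandomizedTreatment

/-- The part `(X, (Y(1), Y(0)))` of a unit on which membership in `classE` depends. -/
def covOutcomes (z : FullData p) : (Fin p → ℝ) × ℝ × ℝ := (cov z, outcomes z)

theorem measurable_covOutcomes : Measurable (covOutcomes : FullData p → (Fin p → ℝ) × ℝ × ℝ) :=
  measurable_cov.prodMk measurable_outcomes

theorem mem_classE_of_map_covOutcomes_absolutelyContinuous {P Q : ProbabilityMeasure (FullData p)}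
    (hP : P ∈ classE p)
    (h : (Q : Measure (FullData p)).map covOutcomes ≪ (P : Measure (FullData p)).map covOutcomes) :
    Q ∈ classE p := by
  obtain ⟨⟨j, hj⟩, h1, h0⟩ := hP
  have hmap : ∀ f : (Fin p → ℝ) × ℝ × ℝ → ℝ, Measurable f →
      (Q : Measure (FullData p)).map (fun z => f (covOutcomes z)) ≪
        (P : Measure (FullData p)).map fun z => f (covOutcomes z) := fun f hf => by
    simpa only [Measure.map_map hf measurable_covOutcomes, Function.comp_def] using h.map hf
  exact ⟨⟨j, (hmap (fun q => q.1 j) (by fun_prop)).trans hj⟩,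
    ⟨fun x => hmap (fun q => q.2.1) (by fun_prop) (h1.1 x)⟩,
    ⟨fun x => hmap (fun q => q.2.2) (by fun_prop) (h0.1 x)⟩⟩

theorem mem_classE_of_absolutelyContinuous {P Q : ProbabilityMeasure (FullData p)}
    (hP : P ∈ classE p) (h : (Q : Measure (FullData p)) ≪ P) : Q ∈ classE p :=
  mem_classE_of_map_covOutcomes_absolutelyContinuous hP (h.map measurable_covOutcomes)

variable (e : Kernel (Fin p → ℝ) Bool) [IsMarkovKernel e] (S : ProbabilityMeasure (FullData p))

/-- The law of a unit drawn from `S` whose treatment is then redrawn from `e X`. -/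
noncomputable def randomizeTreat : ProbabilityMeasure (FullData p) :=
  ⟨((S : Measure (FullData p)).map covOutcomes ⊗ₘ e.prodMkRight (ℝ × ℝ)).map
      MeasurableEquiv.prodAssoc,
    have := Measure.isProbabilityMeasure_map (μ := (S : Measure (FullData p)))
      measurable_covOutcomes.aemeasurable
    Measure.isProbabilityMeasure_map (MeasurableEquiv.measurable _).aemeasurable⟩

theorem map_covOutcomes_treat_randomizeTreat :
    (randomizeTreat e S : Measure (FullData p)).map (fun z => (covOutcomes z, treat z)) =
      (S : Measure (FullData p)).map covOutcomes ⊗ₘ e.prodMkRight (ℝ × ℝ) :=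
  MeasurableEquiv.prodAssoc.map_symm_map

theorem map_covOutcomes_randomizeTreat :
    (randomizeTreat e S : Measure (FullData p)).map covOutcomes =
      (S : Measure (FullData p)).map covOutcomes := by
  rw [← Measure.fst_compProd ((S : Measure (FullData p)).map covOutcomes) (e.prodMkRight (ℝ × ℝ)),
    ← map_covOutcomes_treat_randomizeTreat, Measure.fst_map_prodMk measurable_treat]

theorem map_treat_randomizeTreat_eq_compProd :
    (randomizeTreat e S : Measure (FullData p)).map (fun z => ((cov z, outcomes z), treat z)) =
      (randomizeTreat e S : Measure (FullData p)).map (fun z => (cov z, outcomes z)) ⊗ₘ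
        e.prodMkRight (ℝ × ℝ) :=
  (map_covOutcomes_treat_randomizeTreat e S).trans
    (congrArg (· ⊗ₘ e.prodMkRight (ℝ × ℝ)) (map_covOutcomes_randomizeTreat e S).symm)

theorem randomizeTreat_apply {s : Set (FullData p)} (hs : MeasurableSet s) :
    (randomizeTreat e S : Measure (FullData p)) s =
      ∫⁻ z, e (cov z) {b | (cov z, outcomes z, b) ∈ s} ∂S := by
  have hs' := MeasurableEquiv.prodAssoc.measurable hs
  change (Measure.map _ _) s = _
  rw [MeasurableEquiv.map_apply, Measure.compProd_apply hs',
    lintegral_map (Kernel.measurable_kernel_prodMk_left hs') measurable_covOutcomes]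
  rfl

variable {e S}

theorem smul_le_randomizeTreat {c : ENNReal}
    (h : ∀ᵐ z ∂(S : Measure (FullData p)), c ≤ e (cov z) {treat z}) :
    c • (S : Measure (FullData p)) ≤ randomizeTreat e S := by
  refine Measure.le_iff.2 fun s hs => ?_
  rw [randomizeTreat_apply e S hs, Measure.smul_apply, smul_eq_mul, ← lintegral_indicator_const hs]
  refine lintegral_mono_ae ?_
  filter_upwards [h] with z hz
  by_cases hzs : z ∈ s
  · rw [Set.indicator_of_mem hzs]
    exact hz.trans (measure_mono (Set.singleton_subset_iff.2 hzs))
  · rw [Set.indicator_of_notMem hzs]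
    exact zero_le

theorem randomizeTreat_mem_classSI (hS : S ∈ classE p) : randomizeTreat e S ∈ classSI p := by
  refine ⟨mem_classE_of_map_covOutcomes_absolutelyContinuous hS
    (map_covOutcomes_randomizeTreat e S ▸ Measure.AbsolutelyContinuous.rfl), ?_⟩
  exact condIndepFun_of_map_eq_compProd_prodMkRight measurable_cov measurable_outcomes
    measurable_treat (map_treat_randomizeTreat_eq_compProd e S)

theorem propensity_randomizeTreat :
    propensity (randomizeTreat e S) =ᵐ[(randomizeTreat e S : Measure (FullData p))]
      fun z => (e (cov z)).real {true} := by
  have hcond := condDistrib_ae_eq_of_map_eq_compProd_prodMkRight measurable_cov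
    measurable_outcomes measurable_treat (map_treat_randomizeTreat_eq_compProd e S)
  refine (condDistrib_ae_eq_condExp measurable_cov measurable_treat
    (measurableSet_singleton true)).symm.trans ?_
  filter_upwards [ae_of_ae_map measurable_cov.aemeasurable hcond] with z hz
  rw [hz]

theorem randomizeTreat_mem_classStr (hS : S ∈ classE p) {c : ℝ} (hc : 0 < c)
    (he : ∀ x, (e x).real {true} ∈ Set.Icc c (1 - c)) : randomizeTreat e S ∈ classStr p := by
  refine ⟨randomizeTreat_mem_classSI hS, c, hc, ?_⟩
  filter_upwards [propensity_randomizeTreat] with z hz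
  exact hz ▸ he (cov z)

theorem ae_effect_eq_randomizeTreat {y : ℝ}
    (h : ∀ᵐ z ∂(S : Measure (FullData p)), effect z = y) :
    ∀ᵐ z ∂(randomizeTreat e S : Measure (FullData p)), effect z = y := by
  have hmeas : MeasurableSet {q : (Fin p → ℝ) × ℝ × ℝ | q.2.1 - q.2.2 = y} :=
    measurableSet_eq_fun (by fun_prop) measurable_const
  have hmap := (ae_map_iff measurable_covOutcomes.aemeasurable hmeas).2 h
  rw [← map_covOutcomes_randomizeTreat e S] at hmap
  exact ae_of_ae_map measurable_covOutcomes.aemeasurable hmap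

/-- The treatment rule that follows `A` with probability `q` and deviates from it otherwise. -/
noncomputable def noisyLabel (A : (Fin p → ℝ) → Bool) (hA : Measurable A) (q : unitInterval) :
    Kernel (Fin p → ℝ) Bool :=
  (Kernel.ofFunOfCountable fun b => bernoulliMeasure b (!b) q).comap A hA

variable {A : (Fin p → ℝ) → Bool} {hA : Measurable A} {q : unitInterval}

instance : IsMarkovKernel (noisyLabel A hA q) := by
  have : IsMarkovKernel (Kernel.ofFunOfCountable fun b : Bool => bernoulliMeasure b (!b) q) :=
    ⟨fun b => inferInstanceAs (IsProbabilityMeasure (bernoulliMeasure b (!b) q))⟩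
  exact Kernel.IsMarkovKernel.comap _ hA

theorem noisyLabel_apply (x : Fin p → ℝ) :
    noisyLabel A hA q x = bernoulliMeasure (A x) (!A x) q := rfl

theorem noisyLabel_singleton_label (x : Fin p → ℝ) :
    noisyLabel A hA q x {A x} = ENNReal.ofReal q := by
  rw [noisyLabel_apply, bernoulliMeasure_apply_of_mem_of_notMem q (measurableSet_singleton _) rfl
    (Bool.not_ne_self (A x)), ENNReal.ofReal_eq_coe_nnreal q.2.1]
  rfl

theorem noisyLabel_real_true_mem_Icc (x : Fin p → ℝ) :
    (noisyLabel A hA q x).real {true} ∈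
      Set.Icc (min (q : ℝ) (1 - q)) (1 - min (q : ℝ) (1 - q)) := by
  have hval : (noisyLabel A hA q x).real {true} = if A x then (q : ℝ) else 1 - q := by
    rw [noisyLabel_apply]
    cases A x <;> simp
  rw [hval, Set.mem_Icc, le_sub_comm]
  split_ifs <;> simp

end RandomizedTreatment

section FilledOutcome

/-- The unit `z` with its unobserved potential outcome replaced by the value that makes the
treatment effect equal to `y`. -/
noncomputable def fillOutcome (y : ℝ) (z : FullData p) : FullData p :=
  (cov z, if treat z = true then (y1 z, y1 z - y) else (y0 z + y, y0 z), treat z)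

variable {y : ℝ}

theorem measurable_fillOutcome : Measurable (fillOutcome y : FullData p → FullData p) :=
  measurable_cov.prodMk <| Measurable.prodMk
    (Measurable.ite (measurable_treat (measurableSet_singleton true))
      (measurable_y1.prodMk (measurable_y1.sub_const y))
      ((measurable_y0.add_const y).prodMk measurable_y0))
    measurable_treat

theorem y1_fillOutcome (z : FullData p) :
    y1 (fillOutcome y z) = if treat z = true then y1 z else y0 z + y :=
  apply_ite Prod.fst _ _ _

theorem y0_fillOutcome (z : FullData p) :
    y0 (fillOutcome y z) = if treat z = true then y1 z - y else y0 z :=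
  apply_ite Prod.snd _ _ _

theorem effect_fillOutcome (z : FullData p) : effect (fillOutcome y z) = y := by
  rw [effect, y1_fillOutcome, y0_fillOutcome]
  split_ifs <;> ring

theorem observe_fillOutcome (z : FullData p) : observe (fillOutcome y z) = observe z := by
  have hcov : cov (fillOutcome y z) = cov z := rfl
  have htreat : treat (fillOutcome y z) = treat z := rfl
  simp only [observe, hcov, htreat, y1_fillOutcome, y0_fillOutcome]
  split_ifs <;> rfl

theorem map_fillOutcome_mem_classE {P : ProbabilityMeasure (FullData p)} (hP : P ∈ classE p) :
    P.map (measurable_fillOutcome (y := y)).aemeasurable ∈ classE p := by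
  obtain ⟨⟨j, hj⟩, h1, h0⟩ := hP
  have hshift : ∀ (f : FullData p → ℝ) (c : ℝ), Measurable f →
      NullSingletonClass ((P : Measure (FullData p)).map f) →
      NullSingletonClass ((P : Measure (FullData p)).map fun z => f z + c) := fun f c hf hPf => by
    have := nullSingletonClass_map_of_injective (μ := (P : Measure (FullData p)).map f)
      (measurable_add_const c) (add_left_injective c)
    rwa [Measure.map_map (measurable_add_const c) hf] at this
  have hmap : ∀ f : FullData p → ℝ, Measurable f →
      (P.map (measurable_fillOutcome (y := y)).aemeasurable : Measure (FullData p)).map f =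
        (P : Measure (FullData p)).map fun z => f (fillOutcome y z) := fun f hf => by
    rw [ProbabilityMeasure.toMeasure_map, Measure.map_map hf measurable_fillOutcome]
    rfl
  refine ⟨⟨j, ?_⟩, ?_, ?_⟩
  · exact (hmap _ ((measurable_pi_apply j).comp measurable_cov)).absolutelyContinuous.trans hj
  · have := hshift y0 y measurable_y0 h0
    rw [hmap _ measurable_y1]
    exact nullSingletonClass_map_of_eq_or_eq (measurable_y1.comp measurable_fillOutcome)
      measurable_y1 (measurable_y0.add_const y) fun z =>
        y1_fillOutcome (y := y) z ▸ ite_eq_or_eq _ _ _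
  · have := hshift y1 (-y) measurable_y1 h1
    rw [hmap _ measurable_y0]
    exact nullSingletonClass_map_of_eq_or_eq (measurable_y0.comp measurable_fillOutcome)
      (measurable_y1.add_const (-y)) measurable_y0 fun z =>
        y0_fillOutcome (y := y) z ▸ sub_eq_add_neg (y1 z) y ▸ ite_eq_or_eq _ _ _

end FilledOutcome

section Classes

theorem classStr_subset_classOv : classStr p ⊆ classOv p := by
  rintro P ⟨hP, c, hc, h⟩
  refine ⟨hP, ?_⟩
  filter_upwards [h] with z hz
  exact ⟨hc.trans_le hz.1, sub_pos.1 (hc.trans_le (le_sub_comm.1 hz.2))⟩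

theorem classStr_subset_classMoment {r : ℝ} (hr : 0 ≤ r) : classStr p ⊆ classMoment p r := by
  rintro P ⟨hP, c, hc, h⟩
  refine ⟨hP, ?_⟩
  have hle : ∀ x : ℝ, c ≤ x → ENNReal.ofReal x ^ (-r) ≤ ENNReal.ofReal c ^ (-r) := fun x hx => by
    simpa only [ENNReal.rpow_neg] using
      ENNReal.inv_le_inv.2 (ENNReal.rpow_le_rpow (ENNReal.ofReal_le_ofReal hx) hr)
  have hfin : ENNReal.ofReal c ^ (-r) < ⊤ :=
    (ENNReal.rpow_ne_top_of_ne_zero (ENNReal.ofReal_pos.2 hc).ne' ENNReal.ofReal_ne_top).lt_top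
  calc ∫⁻ z, ENNReal.ofReal (propensity P z) ^ (-r) * ENNReal.ofReal (1 - propensity P z) ^ (-r)
        ∂(P : Measure (FullData p))
      ≤ ∫⁻ _, ENNReal.ofReal c ^ (-r) * ENNReal.ofReal c ^ (-r) ∂(P : Measure (FullData p)) := by
        refine lintegral_mono_ae ?_
        filter_upwards [h] with z hz
        exact mul_le_mul' (hle _ hz.1) (hle _ (le_sub_comm.1 hz.2))
    _ = ENNReal.ofReal c ^ (-r) * ENNReal.ofReal c ^ (-r) := by
        rw [lintegral_const, measure_univ, mul_one]
    _ < ⊤ := ENNReal.mul_lt_top hfin hfin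

theorem classStr_subset {𝓟 : Set (ProbabilityMeasure (FullData p))}
    (h : 𝓟 = classOv p ∨ (∃ r : ℝ, 0 < r ∧ 𝓟 = classMoment p r) ∨ 𝓟 = classStr p) :
    classStr p ⊆ 𝓟 := by
  rcases h with rfl | ⟨r, hr, rfl⟩ | rfl
  · exact classStr_subset_classOv
  · exact classStr_subset_classMoment hr.le
  · exact subset_rfl

theorem nullSingletonClass_map_cov {P : ProbabilityMeasure (FullData p)} (hP : P ∈ classE p) :
    NullSingletonClass ((P : Measure (FullData p)).map cov) := by
  obtain ⟨j, hj⟩ := hP.1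
  have hcoord : Measurable fun x : Fin p → ℝ => x j := measurable_pi_apply j
  have : NullSingletonClass (((P : Measure (FullData p)).map cov).map fun x => x j) := by
    rw [Measure.map_map hcoord measurable_cov]
    exact ⟨fun x => hj (measure_singleton x)⟩
  exact nullSingletonClass_of_map hcoord

end Classes

section Miscoverage

variable {n : ℕ} {Ω : Type*} [MeasurableSpace Ω] {C : PredictionSet Ω n p} {ν : Measure Ω}
  {P Q S : ProbabilityMeasure (FullData p)} {y : ℝ} {a : ENNReal}

theorem PredictionSet.FiniteSampleValid.mono {𝓟 𝓠 : Set (ProbabilityMeasure (FullData p))}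
    {α : ℝ} (h : C.FiniteSampleValid ν 𝓠 α) (h𝓟 : 𝓟 ⊆ 𝓠) : C.FiniteSampleValid ν 𝓟 α :=
  (biSup_mono h𝓟).trans h

/-- The event `y ∉ Ĉ(X)` on the sample space where the new unit is listed last, so that it is
exchangeable with the other units. -/
def missEvent (C : PredictionSet Ω n p) (y : ℝ) : Set (Ω × (Fin (n + 1) → FullData p)) :=
  {w | y ∉ C.toSet w.1 (fun i => observe (w.2 i.castSucc)) (cov (w.2 (Fin.last n)))}

theorem measurableSet_missEvent : MeasurableSet (missEvent C y) := by
  have := measurable_observe (p := p)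
  have := measurable_cov (p := p)
  have hf : Measurable fun w : Ω × (Fin (n + 1) → FullData p) =>
      (w.1, (fun i : Fin n => observe (w.2 i.castSucc)), cov (w.2 (Fin.last n)), y) := by
    fun_prop
  exact (hf C.measurableSet_graph).compl

theorem measurableSet_mem_atNew :
    MeasurableSet {q : (Ω × (Fin n → FullData p) × FullData p) × ℝ | q.2 ∈ C.atNew q.1} := by
  have := measurable_observe (p := p)
  have := measurable_cov (p := p)
  have hf : Measurable fun q : (Ω × (Fin n → FullData p) × FullData p) × ℝ =>
      (q.1.1, (fun i : Fin n => observe (q.1.2.1 i)), cov q.1.2.2, q.2) := by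
    fun_prop
  exact hf C.measurableSet_graph

theorem missPoint_eq_prod_pi_missEvent [SFinite ν] :
    C.missPoint ν P y =
      (ν.prod (Measure.pi fun _ : Fin (n + 1) => (P : Measure (FullData p)))) (missEvent C y) := by
  have hsplit := (MeasurePreserving.id ν).prod
    (measurePreserving_init_last (n := n) (P : Measure (FullData p)))
  have hmeas : MeasurableSet {w : Ω × (Fin n → FullData p) × FullData p | y ∉ C.atNew w} :=
    (measurable_prodMk_right measurableSet_mem_atNew).compl
  exact (hsplit.measure_preimage hmeas.nullMeasurableSet).symm

theorem missEffect_eq_missPoint (h : ∀ᵐ z ∂(P : Measure (FullData p)), effect z = y) :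
    C.missEffect ν P = C.missPoint ν P y := by
  have hnew : ∀ᵐ w ∂experiment ν n P, effect w.2.2 = y :=
    (Measure.quasiMeasurePreserving_snd.comp Measure.quasiMeasurePreserving_snd).ae h
  refine measure_congr (Filter.eventuallyEq_set.2 ?_)
  filter_upwards [hnew] with w hw
  simp only [hw]

theorem missPoint_map_of_observe_eq [SFinite ν] {f : FullData p → FullData p} (hf : Measurable f)
    (hobs : ∀ z, observe (f z) = observe z) :
    C.missPoint ν (P.map hf.aemeasurable) y = C.missPoint ν P y := by
  have hcov : ∀ z, cov (f z) = cov z := fun z => congrArg (fun o : ObsData p => o.1) (hobs z)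
  have hpi : MeasurePreserving (fun (z : Fin (n + 1) → FullData p) i => f (z i))
      (Measure.pi fun _ => (P : Measure (FullData p)))
      (Measure.pi fun _ => (P.map hf.aemeasurable : Measure (FullData p))) :=
    measurePreserving_pi _ _ fun _ => hf.measurePreserving _
  rw [missPoint_eq_prod_pi_missEvent, missPoint_eq_prod_pi_missEvent,
    ← ((MeasurePreserving.id ν).prod hpi).measure_preimage
      measurableSet_missEvent.nullMeasurableSet]
  congr 1
  ext w
  simp only [missEvent, Set.mem_preimage, Set.mem_ofPred_eq, Prod.map_fst, Prod.map_snd, id,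
    hobs, hcov]

theorem pow_mul_missPoint_le [SFinite ν] {c : ENNReal}
    (h : c • (P : Measure (FullData p)) ≤ Q) :
    c ^ (n + 1) * C.missPoint ν P y ≤ C.missPoint ν Q y := by
  have hpi := smul_pi_le_pi (ι := Fin (n + 1)) fun _ => h
  rw [Finset.prod_const, Finset.card_univ, Fintype.card_fin] at hpi
  rw [missPoint_eq_prod_pi_missEvent, missPoint_eq_prod_pi_missEvent, ← smul_eq_mul,
    ← Measure.smul_apply, ← Measure.prod_smul_right]
  exact Measure.prod_mono le_rfl hpi _

theorem missPoint_le_of_treat_eq_of_effect_eq [SFinite ν] (hS : S ∈ classE p)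
    {A : (Fin p → ℝ) → Bool} (hA : Measurable A)
    (htreat : ∀ᵐ z ∂(S : Measure (FullData p)), treat z = A (cov z))
    (heffect : ∀ᵐ z ∂(S : Measure (FullData p)), effect z = y)
    (hC : ∀ Q ∈ classStr p, C.missEffect ν Q ≤ a) : C.missPoint ν S y ≤ a := by
  have hnoisy : ∀ q ∈ Set.Ioo (0 : ℝ) 1,
      ENNReal.ofReal q ^ (n + 1) * C.missPoint ν S y ≤ a := fun q hq => by
    let r : unitInterval := ⟨q, Set.Ioo_subset_Icc_self hq⟩
    let Q := randomizeTreat (noisyLabel A hA r) S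
    have hQ : Q ∈ classStr p := randomizeTreat_mem_classStr hS
      (lt_min hq.1 (sub_pos.2 hq.2)) (noisyLabel_real_true_mem_Icc (q := r))
    have hdom : ENNReal.ofReal q • (S : Measure (FullData p)) ≤ Q := by
      refine smul_le_randomizeTreat ?_
      filter_upwards [htreat] with z hz
      rw [hz, noisyLabel_singleton_label]
    calc ENNReal.ofReal q ^ (n + 1) * C.missPoint ν S y
        ≤ C.missPoint ν Q y := pow_mul_missPoint_le hdom
      _ = C.missEffect ν Q := (missEffect_eq_missPoint (ae_effect_eq_randomizeTreat heffect)).symm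
      _ ≤ a := hC Q hQ
  have hlim : Filter.Tendsto (fun q => ENNReal.ofReal q ^ (n + 1) * C.missPoint ν S y)
      (nhdsWithin (1 : ℝ) (Set.Iio 1)) (nhds (C.missPoint ν S y)) := by
    have hq : Filter.Tendsto ENNReal.ofReal (nhdsWithin 1 (Set.Iio 1)) (nhds 1) :=
      ENNReal.ofReal_one ▸ ENNReal.continuous_ofReal.continuousWithinAt.tendsto
    simpa only [one_pow, one_mul] using
      ENNReal.Tendsto.mul_const (ENNReal.Tendsto.pow (n := n + 1) hq) (.inl (by simp))
  exact le_of_tendsto hlim (Filter.eventually_of_mem (Ioo_mem_nhdsLT one_pos) hnoisy)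

theorem missPoint_le_of_treat_eq [SFinite ν] (hP : P ∈ classE p) {A : (Fin p → ℝ) → Bool}
    (hA : Measurable A) (htreat : ∀ᵐ z ∂(P : Measure (FullData p)), treat z = A (cov z))
    (hC : ∀ Q ∈ classStr p, C.missEffect ν Q ≤ a) : C.missPoint ν P y ≤ a := by
  have hfill := measurable_fillOutcome (p := p) (y := y)
  have hlabel : MeasurableSet {z : FullData p | treat z = A (cov z)} :=
    measurableSet_eq_fun measurable_treat (hA.comp measurable_cov)
  rw [← missPoint_map_of_observe_eq hfill observe_fillOutcome]
  refine missPoint_le_of_treat_eq_of_effect_eq (map_fillOutcome_mem_classE hP) hA ?_ ?_ hC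
  · exact (ae_map_iff hfill.aemeasurable hlabel).2 htreat
  · exact (ae_map_iff hfill.aemeasurable (measurable_effect (measurableSet_singleton y))).2
      (.of_forall effect_fillOutcome)

theorem missPoint_le_of_forall_classStr [IsFiniteMeasure ν] (hP : P ∈ classE p)
    (hC : ∀ Q ∈ classStr p, C.missEffect ν Q ≤ a) : C.missPoint ν P y ≤ a := by
  have := nullSingletonClass_map_cov hP
  rw [missPoint_eq_prod_pi_missEvent]
  refine prod_pi_le_of_forall_label measurable_cov measurable_treat measurableSet_missEvent
    fun μ hμ hac A hA htreat => ?_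
  have hclass := mem_classE_of_absolutelyContinuous (Q := ⟨μ, hμ⟩) hP hac
  exact missPoint_eq_prod_pi_missEvent.symm.trans_le (missPoint_le_of_treat_eq hclass hA htreat hC)

theorem expectedLength_eq_top [IsProbabilityMeasure ν] (ha : a < 1)
    (h : ∀ y, C.missPoint ν P y ≤ a) : C.expectedLength ν P = ⊤ := by
  have : IsProbabilityMeasure (experiment ν n P) :=
    inferInstanceAs (IsProbabilityMeasure (ν.prod _))
  have hcover : ∀ y, 1 - a ≤ experiment ν n P {w | y ∈ C.atNew w} := fun y => by
    have hmeas : MeasurableSet {w | y ∈ C.atNew w} :=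
      measurable_prodMk_right measurableSet_mem_atNew
    calc 1 - a ≤ 1 - C.missPoint ν P y := tsub_le_tsub_left (h y) 1
      _ = experiment ν n P {w | y ∈ C.atNew w} := by
          rw [← compl_compl {w | y ∈ C.atNew w}, prob_compl_eq_one_sub hmeas.compl]
          rfl
  refine top_unique ?_
  calc (⊤ : ENNReal) = ∫⁻ _ : ℝ, (1 - a) := by
        rw [lintegral_const, Real.volume_univ, ENNReal.mul_top (tsub_pos_of_lt ha).ne']
    _ ≤ ∫⁻ y, experiment ν n P {w | y ∈ C.atNew w} := lintegral_mono hcover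
    _ = ((experiment ν n P).prod volume) {q | q.2 ∈ C.atNew q.1} :=
        (Measure.prod_apply_symm measurableSet_mem_atNew).symm
    _ = C.expectedLength ν P := Measure.prod_apply measurableSet_mem_atNew

end Miscoverage
end ITE

theorem mainTheorem2_general {p n : ℕ} {Ω : Type*} [MeasurableSpace Ω] (ν : Measure Ω)
    [IsProbabilityMeasure ν] (C : ITE.PredictionSet Ω n p) (α : ℝ) (hα : α < 1)
    (hC : C.FiniteSampleValid ν (ITE.classStr p) α)
    (P : ProbabilityMeasure (ITE.FullData p)) (hP : P ∈ ITE.classE p) :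
    (∀ y : ℝ, C.missPoint ν P y ≤ ENNReal.ofReal α) ∧ C.expectedLength ν P = ⊤ := by
  have hpoint : ∀ y : ℝ, C.missPoint ν P y ≤ ENNReal.ofReal α := fun y =>
    ITE.missPoint_le_of_forall_classStr hP (iSup₂_le_iff.1 hC)
  exact ⟨hpoint, ITE.expectedLength_eq_top (ENNReal.ofReal_lt_one.2 hα) hpoint⟩

theorem mainTheorem2 {p n : ℕ} {Ω : Type*} [MeasurableSpace Ω]
    (ν : MeasureTheory.Measure Ω) [MeasureTheory.IsProbabilityMeasure ν]
    (C : ITE.PredictionSet Ω n p)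
    (𝓟 : Set (MeasureTheory.ProbabilityMeasure (ITE.FullData p)))
    (hClass : 𝓟 = ITE.classOv p ∨ (∃ r : ℝ, 0 < r ∧ 𝓟 = ITE.classMoment p r) ∨ 𝓟 = ITE.classStr p)
    (α : ℝ) (hα : α ∈ Set.Ioo (0 : ℝ) 1)
    (hC : C.FiniteSampleValid ν 𝓟 α)
    (P : MeasureTheory.ProbabilityMeasure (ITE.FullData p)) (hP : P ∈ ITE.classSI p) :
    (∀ y : ℝ, C.missPoint ν P y ≤ ENNReal.ofReal α) ∧ C.expectedLength ν P = ⊤ :=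
  mainTheorem2_general ν C α hα.2 (hC.mono (ITE.classStr_subset hClass)) P hP.1
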